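/- A real Banach lattice $X$ has \emph{order continuous norm} if, for every increasing net $(x_\alpha)$ in $X$ that has a least upper bound $x$ in $X$, one has $\lim_\alpha\|x-x_\alpha\|=0$. Write $X_+=\{x\in X: x\ge 0\}$, let $u\wedge v$ denote the infimum of $u$ and $v$, and let $\operatorname{co}$ denote the convex hull. \textbf{Theorem.} Let $X$ be a real Banach lattice with order continuous norm, let $(x_n)_{n\in\mathbb N}$ be a sequence in $X_+$ (not assumed to be norm bounded), and let $z\in X_+$. Then there exist three sequences $(y_n)_{n\in\mathbb N}$, $(\zeta_n)_{n\in\mathbb N}$ and $(\xi_k)_{k\in\mathbb N}$ in $X_+$ such that (i) $y_n\in\operatorname{co}(x_n,x_{n+1},\ldots)$ for every $n$; (ii) $\zeta_n\le y_n$ for every $n$; (iii) $(\xi_k)$ is increasing, i.e. $\xi_k\le\xi_{k+1}$ for every $k$; and, for every $k\in\mathbb N=\{0,1,2,\ldots\}$, $$\lim_{n\to\infty}\big\|\zeta_n\wedge 2^kz-\xi_k\big\|=0 \qquad\text{and}\qquad y_n\wedge 2^kz\to\xi_k\ \text{ weakly in } X \text{ as } n\to\infty .$$ -/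

import Mathlib

open Filter Topology

universe u

/-- The norm of a normed lattice `X` is order continuous: every increasing net in `X` that has a
least upper bound `a` in `X` converges to `a` in norm. An increasing net has the same upper bounds
and the same norm limits as its range, directed by the order of `X`, so index types in the universe
of `X` cover all nets. -/
def HasOrderContinuousNorm (X : Type u) [NormedAddCommGroup X] [Lattice X] : Prop :=
  ∀ (ι : Type u) [Preorder ι] [Nonempty ι] [IsDirected ι (· ≤ ·)] (f : ι → X) (a : X),
    Monotone f → IsLUB (Set.range f) a → Tendsto (fun i => ‖a - f i‖) atTop (𝓝 0)

/-- The set `Γ(x)` of all sequences `y` with `y n ∈ co (x n, x (n + 1), …)` for every `n`. -/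
def forwardConvexSequences {X : Type u} [AddCommGroup X] [Module ℝ X] (x : ℕ → X) :
    Set (ℕ → X) :=
  {y | ∀ n, y n ∈ convexHull ℝ (x '' Set.Ici n)}

/-! One may take `ζ = y`: suitable forward convex combinations have truncations that already
converge in norm, which gives the weak limits too.

Order continuity yields a positive functional `φ`, strictly positive on `[0, z]`, and smallness of
`φ` forces smallness of the norm there (`exists_strictly_positive`, `exists_norm_lt_of_apply_lt`).
So it suffices to make truncations Cauchy for `φ ∘ |·|`.

Each `v ↦ φ (v ⊓ c)` is concave, and its midpoint defect at `a, b` dominates half of `φ ((a - c)⁺ ⊓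
(b - c)⁻)`, the overlap where `a` is above and `b` below `c`. Let `y n` almost maximise a weighted
sum of these functionals, `c` running over the nonnegative rational multiples of `z`, over the
`n`-th forward hull. Midpoints cannot do much better, so all overlaps tend to zero
(`exists_forwardConvex_tendsto_overlap`). Two elements lying on the same side of every level of a
mesh `d` have truncations within `d` (`abs_inf_sub_inf_le_add_sum`), and the mesh is arbitrarily
fine. -/

theorem posPart_smul_of_pos {X : Type*} [AddCommGroup X] [Lattice X] [Module ℝ X]
    [IsOrderedModule ℝ X] {c : ℝ} (hc : 0 < c) (x : X) : (c • x)⁺ = c • x⁺ := by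
  have h : c • (x ⊔ 0) = c • x ⊔ c • (0 : X) := (OrderIso.smulRight hc : X ≃o X).map_sup x 0
  rw [posPart_def, posPart_def, h, smul_zero]

/-! ### Monotone sequences and tail suprema under order continuity -/

section OrderContinuous

variable {X : Type u} [NormedAddCommGroup X] [Lattice X] [HasSolidNorm X]

/-- The norm of a normed lattice is monotone on the positive cone. -/
theorem norm_le_norm_of_nonneg_of_le [IsOrderedAddMonoid X] {a b : X} (ha : 0 ≤ a) (hab : a ≤ b) :
    ‖a‖ ≤ ‖b‖ :=
  norm_le_norm_of_abs_le_abs (by rwa [abs_of_nonneg ha, abs_of_nonneg (ha.trans hab)])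

variable [NormedSpace ℝ X] [IsOrderedAddMonoid X] [IsOrderedModule ℝ X]

/-- Normed lattices are Archimedean. -/
theorem nonneg_of_forall_neg_nsmul_le {v b : X} (h : ∀ k : ℕ, -(k • v) ≤ b) : 0 ≤ v := by
  have hlim : Tendsto (fun k : ℕ => (1 / ((k : ℝ) + 1)) • b) atTop (𝓝 0) := by
    simpa using (tendsto_one_div_add_atTop_nhds_zero_nat (𝕜 := ℝ)).smul_const b
  refine neg_nonpos.1 (ge_of_tendsto' hlim fun k => ?_)
  have hk : (0 : ℝ) < (k : ℝ) + 1 := by positivity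
  have h1 := smul_le_smul_of_nonneg_left (h (k + 1)) (one_div_pos.2 hk).le
  rwa [← Nat.cast_smul_eq_nsmul ℝ, ← smul_neg, smul_smul, Nat.cast_add, Nat.cast_one,
    one_div_mul_cancel hk.ne', one_smul] at h1

/-- An order bounded increasing sequence is Cauchy if the norm is order continuous. -/
theorem HasOrderContinuousNorm.cauchySeq_of_monotone (hX : HasOrderContinuousNorm X) {a : ℕ → X}
    (ha : Monotone a) {b : X} (hb : ∀ n, a n ≤ b) : CauchySeq a := by
  -- No supremum of `a` is known to exist, so the hypothesis is applied to the net `a n - u`, with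
  -- `u` decreasing through the upper bounds of `a`; its supremum is `0`.
  let U := {u : X // ∀ n, a n ≤ u}
  let f : Uᵒᵈ × ℕ → X := fun p => a p.2 - (OrderDual.ofDual p.1).1
  have : Nonempty Uᵒᵈ := ⟨OrderDual.toDual ⟨b, hb⟩⟩
  have : IsDirected Uᵒᵈ (· ≤ ·) := ⟨fun u v =>
    ⟨OrderDual.toDual ⟨(OrderDual.ofDual u).1 ⊓ (OrderDual.ofDual v).1,
      fun n => le_inf ((OrderDual.ofDual u).2 n) ((OrderDual.ofDual v).2 n)⟩,
      show _ ⊓ _ ≤ _ from inf_le_left, show _ ⊓ _ ≤ _ from inf_le_right⟩⟩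
  have : IsDirected (Uᵒᵈ × ℕ) (· ≤ ·) := ⟨fun p q =>
    let ⟨c, hp, hq⟩ := directed_of (· ≤ ·) p.1 q.1
    ⟨(c, p.2 ⊔ q.2), ⟨hp, le_sup_left⟩, ⟨hq, le_sup_right⟩⟩⟩
  have hf : Monotone f := fun p q hpq => sub_le_sub (ha hpq.2) hpq.1
  have hlub : IsLUB (Set.range f) 0 := by
    constructor
    · rintro _ ⟨p, rfl⟩
      exact sub_nonpos.2 ((OrderDual.ofDual p.1).2 p.2)
    · intro v hv
      -- If `v` bounds the net, adding `v` to an upper bound of `a` gives another one. Iterating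
      -- from `b` and using the Archimedean property gives `0 ≤ v`.
      have hstep : ∀ k : ℕ, ∀ n, a n ≤ b + k • v := by
        intro k
        induction k with
        | zero => simpa using hb
        | succ k ih =>
          intro n
          have := hv ⟨(OrderDual.toDual ⟨b + k • v, ih⟩, n), rfl⟩
          rw [succ_nsmul, ← add_assoc, add_comm _ v]
          exact sub_le_iff_le_add.1 this
      refine nonneg_of_forall_neg_nsmul_le (b := b - a 0) fun k => ?_
      rw [neg_le_sub_iff_le_add]
      exact hstep k 0
  have hlim := hX _ f 0 hf hlub
  rw [Metric.cauchySeq_iff']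
  intro ε hε
  obtain ⟨⟨v, N⟩, hN⟩ := eventually_atTop.1 (hlim.eventually (gt_mem_nhds hε))
  refine ⟨N, fun n hn => ?_⟩
  rw [dist_eq_norm]
  refine lt_of_le_of_lt ?_ (hN (v, N) le_rfl)
  refine norm_le_norm_of_nonneg_of_le (sub_nonneg.2 (ha hn)) ?_
  simpa [f] using (OrderDual.ofDual v).2 n

/-- The suprema `w n` of the tails of a positive order bounded sequence `u`, together with
countable subadditivity of positive functionals on them. -/
theorem HasOrderContinuousNorm.exists_tail_suprema [CompleteSpace X]
    (hX : HasOrderContinuousNorm X) {u : ℕ → X} {z : X} (hu : ∀ n, 0 ≤ u n) (huz : ∀ n, u n ≤ z) :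
    ∃ w : ℕ → X, Antitone w ∧ (∀ n, u n ≤ w n) ∧ (∀ n, w n ≤ z) ∧ CauchySeq w ∧
      ∀ ψ : X →L[ℝ] ℝ, (∀ x, 0 ≤ x → 0 ≤ ψ x) → ∀ n, Summable (fun i => ψ (u (n + i))) →
        ψ (w n) ≤ ∑' i, ψ (u (n + i)) := by
  have hz : ∀ n m, partialSups (fun i => u (n + i)) m ≤ z := fun n m =>
    partialSups_le _ _ _ fun j _ => huz _
  -- Obtaining the suprema as norm limits of finite suprema lets continuous functionals pass to
  -- them.
  have hlim : ∀ n, ∃ a, Tendsto (fun m => partialSups (fun i => u (n + i)) m) atTop (𝓝 a) :=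
    fun n => cauchySeq_tendsto_of_complete
      (hX.cauchySeq_of_monotone (partialSups_monotone _) (hz n))
  choose w hw using hlim
  have hle : ∀ n m, partialSups (fun i => u (n + i)) m ≤ w n := fun n m =>
    (partialSups_monotone _).ge_of_tendsto (hw n) m
  have huw : ∀ n, u n ≤ w n := fun n => by simpa using hle n 0
  have hanti : Antitone w := antitone_nat_of_succ_le fun n =>
    le_of_tendsto' (hw (n + 1)) fun m => partialSups_le _ _ _ fun j _ => by
      have := (le_partialSups (fun i => u (n + i)) (j + 1)).trans (hle n (j + 1))
      simpa [add_assoc, add_comm 1 j] using this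
  refine ⟨w, hanti, huw, fun n => le_of_tendsto' (hw n) (hz n), ?_, fun ψ hψ n hs => ?_⟩
  · have := hX.cauchySeq_of_monotone (a := fun n => -w n) (fun m n h => neg_le_neg (hanti h))
      (b := 0) fun n => neg_nonpos.2 ((hu n).trans (huw n))
    simpa [Pi.neg_def] using this.neg
  · refine le_of_tendsto' ((ψ.continuous.tendsto _).comp (hw n)) fun m => ?_
    have hmono : ∀ x y, x ≤ y → ψ x ≤ ψ y := fun x y h => by
      simpa using hψ _ (sub_nonneg.2 h)
    have h1 : partialSups (fun i => u (n + i)) m ≤ ∑ i ∈ Finset.range (m + 1), u (n + i) :=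
      partialSups_le _ _ _ fun j hj =>
        Finset.single_le_sum (f := fun i => u (n + i)) (fun i _ => hu _)
          (Finset.mem_range.2 (Nat.lt_succ_of_le hj))
    calc ψ (partialSups (fun i => u (n + i)) m)
        ≤ ψ (∑ i ∈ Finset.range (m + 1), u (n + i)) := hmono _ _ h1
      _ = ∑ i ∈ Finset.range (m + 1), ψ (u (n + i)) := map_sum ψ _ _
      _ ≤ ∑' i, ψ (u (n + i)) := hs.sum_le_tsum _ fun i _ => hψ _ (hu _)

end OrderContinuous

/-! ### Strictly positive functionals on order intervals -/

section PositiveFunctionals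

variable {X : Type u} [NormedAddCommGroup X] [Lattice X] [HasSolidNorm X] [NormedSpace ℝ X]
  [IsOrderedAddMonoid X] [IsOrderedModule ℝ X]

/-- A positive element of a normed lattice is normed by a positive functional of norm at most
one. -/
theorem exists_positive_functional_norming {u : X} (hu : 0 ≤ u) :
    -- Hahn–Banach with the majorant `‖x⁺‖` instead of `‖x‖`: it vanishes on `-x` for `x ≥ 0`, which
    -- forces positivity of the extension.
    ∃ ψ : X →L[ℝ] ℝ, (∀ x, 0 ≤ x → 0 ≤ ψ x) ∧ ‖ψ‖ ≤ 1 ∧ ψ u = ‖u‖ := by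
  have hext := exists_extension_of_le_sublinear
    (LinearPMap.mkSpanSingleton' u ‖u‖ (fun c hc => by
      rcases smul_eq_zero.1 hc with h | h <;> simp [h]) : X →ₗ.[ℝ] ℝ)
    (fun x => ‖x⁺‖)
    (fun c hc x => by simp only [posPart_smul_of_pos hc x, norm_smul, Real.norm_eq_abs, abs_of_pos hc])
    (fun x y => (norm_le_norm_of_nonneg_of_le (posPart_nonneg _)
      (sup_le (add_le_add (le_posPart x) (le_posPart y))
        (add_nonneg (posPart_nonneg x) (posPart_nonneg y)))).trans (norm_add_le _ _)) ?_
  · obtain ⟨g, hg, hgN⟩ := hext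
    have hle : ∀ x, g x ≤ ‖x‖ := fun x => (hgN x).trans
      (norm_le_norm_of_abs_le_abs (by
        rw [abs_of_nonneg (posPart_nonneg x)]; exact sup_le (le_abs_self x) (abs_nonneg x)))
    refine ⟨g.mkContinuous 1 fun x => ?_, fun x hx => ?_, g.mkContinuous_norm_le zero_le_one _, ?_⟩
    · rw [one_mul, Real.norm_eq_abs, abs_le]
      exact ⟨by have := hle (-x); rw [map_neg, norm_neg] at this; linarith, hle x⟩
    · have := hgN (-x)
      rw [posPart_eq_zero.2 (neg_nonpos.2 hx), map_neg, norm_zero] at this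
      simpa using this
    · have := hg ⟨u, Submodule.mem_span_singleton_self u⟩
      rw [LinearMap.mkContinuous_apply]
      exact this.trans (LinearPMap.mkSpanSingleton'_apply_self _ _ _ _)
  · rintro ⟨x, hx⟩
    obtain ⟨c, rfl⟩ := Submodule.mem_span_singleton.1 hx
    rw [LinearPMap.mkSpanSingleton'_apply]
    rcases le_or_gt c 0 with hc | hc
    · exact (mul_nonpos_of_nonpos_of_nonneg hc (norm_nonneg u)).trans (norm_nonneg _)
    · simp only [posPart_smul_of_pos hc u, norm_smul, Real.norm_eq_abs, abs_of_pos hc, posPart_of_nonneg hu,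
        smul_eq_mul, RingHom.id_apply, le_refl]

/-- If the norm is order continuous, every order interval `[0, z]` carries a strictly positive
functional. -/
theorem HasOrderContinuousNorm.exists_strictly_positive [CompleteSpace X]
    (hX : HasOrderContinuousNorm X) {z : X} (hz : 0 ≤ z) :
    ∃ φ : X →L[ℝ] ℝ, (∀ x, 0 ≤ x → 0 ≤ φ x) ∧ ∀ u, 0 ≤ u → u ≤ z → φ u = 0 → u = 0 := by
  have hstep : ∀ φ : X →L[ℝ] ℝ, ∃ u : X, ∃ ψ : X →L[ℝ] ℝ, (0 ≤ u ∧ u ≤ z ∧ φ u = 0) ∧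
      (∀ v, 0 ≤ v → v ≤ z → φ v = 0 → ‖v‖ ≤ 2 * ‖u‖) ∧
      (∀ x, 0 ≤ x → 0 ≤ ψ x) ∧ ‖ψ‖ ≤ 1 ∧ ψ u = ‖u‖ := by
    intro φ
    let S : Set ℝ := {r | ∃ v, 0 ≤ v ∧ v ≤ z ∧ φ v = 0 ∧ ‖v‖ = r}
    have hbdd : BddAbove S := ⟨‖z‖, by
      rintro _ ⟨v, hv, hvz, -, rfl⟩; exact norm_le_norm_of_nonneg_of_le hv hvz⟩
    have hmem : ∃ u, (0 ≤ u ∧ u ≤ z ∧ φ u = 0) ∧ sSup S ≤ 2 * ‖u‖ := by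
      rcases le_or_gt (sSup S) 0 with h | h
      · exact ⟨0, ⟨le_rfl, hz, map_zero φ⟩, by simpa using h⟩
      · obtain ⟨_, ⟨u, hu, huz, hφ, rfl⟩, hlt⟩ :=
          exists_lt_of_lt_csSup (s := S) ⟨0, 0, le_rfl, hz, map_zero φ, norm_zero⟩ (half_lt_self h)
        exact ⟨u, ⟨hu, huz, hφ⟩, by linarith⟩
    obtain ⟨u, hu, hS⟩ := hmem
    obtain ⟨ψ, hψ⟩ := exists_positive_functional_norming hu.1
    exact ⟨u, ψ, hu, fun v hv hvz hφ => (le_csSup hbdd ⟨v, hv, hvz, hφ, rfl⟩).trans hS, hψ⟩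
  choose U Ψ hU hmax hΨ hΨn hΨU using hstep
  -- Exhaustion: each stage adds, with weight `2⁻ⁿ`, a functional norming an element of `[0, z]`
  -- killed so far whose norm is within a factor 2 of the largest possible.
  let Φ : ℕ → X →L[ℝ] ℝ := fun n => Nat.rec 0 (fun n φ => φ + ((1 / 2 : ℝ) ^ n) • Ψ φ) n
  have hΦ : ∀ n, Φ n = ∑ i ∈ Finset.range n, ((1 / 2 : ℝ) ^ i) • Ψ (Φ i) := by
    intro n
    induction n with
    | zero => rfl
    | succ n ih => rw [Finset.sum_range_succ, ← ih]
  have hsum : Summable fun i => ((1 / 2 : ℝ) ^ i) • Ψ (Φ i) := by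
    refine Summable.of_norm_bounded summable_geometric_two fun i => ?_
    rw [norm_smul, norm_pow]
    calc ‖(1 / 2 : ℝ)‖ ^ i * ‖Ψ (Φ i)‖ ≤ ‖(1 / 2 : ℝ)‖ ^ i * 1 :=
          mul_le_mul_of_nonneg_left (hΨn _) (by positivity)
      _ = (1 / 2 : ℝ) ^ i := by norm_num
  have heval : ∀ x, HasSum (fun i => (1 / 2 : ℝ) ^ i * Ψ (Φ i) x)
      ((∑' i, ((1 / 2 : ℝ) ^ i) • Ψ (Φ i)) x) := fun x => by
    simpa using (ContinuousLinearMap.apply ℝ ℝ x).hasSum hsum.hasSum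
  have hterm : ∀ i x, 0 ≤ x → 0 ≤ (1 / 2 : ℝ) ^ i * Ψ (Φ i) x := fun i x hx =>
    mul_nonneg (by positivity) (hΨ _ x hx)
  refine ⟨∑' i, ((1 / 2 : ℝ) ^ i) • Ψ (Φ i), fun x hx => (heval x).nonneg fun i => hterm i x hx,
    fun v hv hvz h0 => ?_⟩
  have hΨv : ∀ i, (1 / 2 : ℝ) ^ i * Ψ (Φ i) v = 0 := by
    have := heval v
    rw [h0, hasSum_zero_iff_of_nonneg fun i => hterm i v hv] at this
    exact fun i => congrFun this i
  have hvU : ∀ n, ‖v‖ ≤ 2 * ‖U (Φ n)‖ := fun n => hmax (Φ n) v hv hvz (by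
    rw [hΦ n, sum_apply]
    exact Finset.sum_eq_zero fun i _ => by simpa using hΨv i)
  have hΨU0 : ∀ i n, i < n → Ψ (Φ i) (U (Φ n)) = 0 := by
    intro i n hin
    have h1 := (hU (Φ n)).2.2
    nth_rewrite 1 [hΦ n] at h1
    rw [sum_apply, Finset.sum_eq_zero_iff_of_nonneg
      fun j _ => by simpa using hterm j _ (hU (Φ n)).1] at h1
    simpa using h1 i (Finset.mem_range.2 hin)
  obtain ⟨w, -, huw, -, hcau, hw⟩ := hX.exists_tail_suprema (u := fun n => U (Φ n))
    (fun n => (hU _).1) fun n => (hU _).2.1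
  -- `Ψ (Φ n)` kills all later `U (Φ m)`, hence `w (n + 1)`, but takes the value `‖U (Φ n)‖` at `U
  -- (Φ n) ≤ w n`. Since `w` is Cauchy, the norms tend to zero.
  have hdiff : ∀ n, ‖U (Φ n)‖ ≤ ‖w n - w (n + 1)‖ := by
    intro n
    have hz0 : ∀ i, Ψ (Φ n) (U (Φ (n + 1 + i))) = 0 := fun i => hΨU0 _ _ (by omega)
    have h1 := hw (Ψ (Φ n)) (hΨ _) (n + 1) (by simpa only [hz0] using summable_zero)
    simp only [hz0, tsum_zero] at h1
    have h2 := hΨ (Φ n) _ (sub_nonneg.2 (huw n))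
    rw [map_sub, hΨU] at h2
    calc ‖U (Φ n)‖ ≤ Ψ (Φ n) (w n - w (n + 1)) := by rw [map_sub]; linarith
      _ ≤ ‖Ψ (Φ n) (w n - w (n + 1))‖ := le_abs_self _
      _ ≤ 1 * ‖w n - w (n + 1)‖ := (Ψ (Φ n)).le_of_opNorm_le (hΨn _) _
      _ = _ := one_mul _
  obtain ⟨a, ha⟩ := cauchySeq_tendsto_of_complete hcau
  have hlim : Tendsto (fun n => 2 * ‖w n - w (n + 1)‖) atTop (𝓝 0) := by
    simpa using ((ha.sub (ha.comp (tendsto_add_atTop_nat 1))).norm).const_mul 2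
  exact norm_le_zero_iff.1 (ge_of_tendsto' hlim fun n =>
    (hvU n).trans (mul_le_mul_of_nonneg_left (hdiff n) zero_le_two))

/-- If the norm is order continuous, a strictly positive functional on `[0, z]` controls the norm
of `[0, z]` uniformly. -/
theorem HasOrderContinuousNorm.exists_norm_lt_of_apply_lt [CompleteSpace X]
    (hX : HasOrderContinuousNorm X) {z : X} {φ : X →L[ℝ] ℝ} (hφ : ∀ x, 0 ≤ x → 0 ≤ φ x)
    (hφz : ∀ u, 0 ≤ u → u ≤ z → φ u = 0 → u = 0) {ε : ℝ} (hε : 0 < ε) :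
    ∃ δ > 0, ∀ u, 0 ≤ u → u ≤ z → φ u < δ → ‖u‖ < ε := by
  by_contra! hcon
  -- The geometric bound makes `φ` summable along `u`, so `φ` kills the limit of the tail suprema.
  -- That limit is then `0`, although the suprema have norm at least `ε`.
  choose u hu huz huφ huε using fun n : ℕ => hcon ((1 / 2 : ℝ) ^ n) (by positivity)
  obtain ⟨w, -, huw, hwz, hcau, hw⟩ := hX.exists_tail_suprema hu huz
  obtain ⟨a, ha⟩ := cauchySeq_tendsto_of_complete hcau
  have hbound : ∀ n, φ (w n) ≤ (1 / 2 : ℝ) ^ n * 2 := by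
    intro n
    have hgeo : HasSum (fun i => (1 / 2 : ℝ) ^ (n + i)) ((1 / 2 : ℝ) ^ n * 2) := by
      simpa only [pow_add] using hasSum_geometric_two.mul_left ((1 / 2 : ℝ) ^ n)
    have hs : Summable fun i => φ (u (n + i)) :=
      Summable.of_nonneg_of_le (fun i => hφ _ (hu _)) (fun i => (huφ _).le) hgeo.summable
    exact (hw φ hφ n hs).trans (hasSum_le (fun i => (huφ _).le) hs.hasSum hgeo)
  have ha0 : 0 ≤ a := ge_of_tendsto' ha fun n => (hu n).trans (huw n)
  have hlim : Tendsto (fun n => (1 / 2 : ℝ) ^ n * 2) atTop (𝓝 0) := by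
    simpa using (tendsto_pow_atTop_nhds_zero_of_lt_one (r := (1 / 2 : ℝ)) (by norm_num)
      (by norm_num)).mul_const 2
  have hφa : φ a ≤ 0 := le_of_tendsto_of_tendsto' ((φ.continuous.tendsto a).comp ha) hlim hbound
  rw [hφz a ha0 (le_of_tendsto' ha hwz) (hφa.antisymm (hφ a ha0))] at ha
  refine hε.not_ge (ge_of_tendsto' (by simpa using ha.norm) fun n => ?_)
  exact (huε n).trans (norm_le_norm_of_nonneg_of_le (hu n) (huw n))

end PositiveFunctionals

/-! ### Lattice inequalities for truncations and overlaps -/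

section LatticeGroup

variable {G : Type*} [AddCommGroup G] [Lattice G] [IsOrderedAddMonoid G]

/-- Cancellation between `s⁺` and `t⁻` is lost when positive parts are taken separately; this
becomes the concavity defect of truncation. -/
theorem posPart_inf_negPart_le (s t : G) : s⁺ ⊓ t⁻ ≤ s⁺ + t⁺ - (s + t)⁺ := by
  rw [le_sub_comm]
  refine sup_le ?_ ?_
  · calc s + t = s + (t⁺ - t⁻) := by rw [posPart_sub_negPart]
      _ ≤ s⁺ + (t⁺ - s⁺ ⊓ t⁻) :=
        add_le_add (le_posPart s) (sub_le_sub_left inf_le_right _)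
      _ = _ := by abel
  · exact sub_nonneg.2 (inf_le_left.trans (le_add_of_nonneg_right (posPart_nonneg t)))

theorem inf_add_le_inf_add_inf {v a b : G} (hv : 0 ≤ v) (ha : 0 ≤ a) (hb : 0 ≤ b) :
    v ⊓ (a + b) ≤ v ⊓ a + v ⊓ b := by
  rw [← sub_le_iff_le_add', sub_inf]
  refine sup_le (le_inf ?_ ?_) (le_inf ?_ ?_)
  · exact (sub_nonpos.2 inf_le_left).trans hv
  · exact (sub_nonpos.2 inf_le_left).trans hb
  · exact (sub_le_self _ ha).trans inf_le_left
  · exact sub_le_iff_le_add'.2 inf_le_right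

/-- If `v ≤ p (i + 1) + q i` for all `i`, then `v` is controlled by the overlaps `p i ⊓ q i`. -/
theorem le_inf_add_sum_inf {v : G} {p q : ℕ → G} (hv : 0 ≤ v) (hp : ∀ i, 0 ≤ p i)
    (hq : ∀ i, 0 ≤ q i) (h : ∀ i, v ≤ p (i + 1) + q i) (hq0 : q 0 = 0) (n : ℕ) :
    v ≤ v ⊓ p (n + 1) + ∑ i ∈ Finset.range (n + 1), p i ⊓ q i := by
  induction n with
  | zero =>
    have h0 := h 0
    rw [hq0, add_zero] at h0
    simp only [zero_add, Finset.range_one, Finset.sum_singleton, inf_eq_left.2 h0]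
    exact le_add_of_nonneg_right (le_inf (hp 0) (hq 0))
  | succ n ih =>
    refine ih.trans ?_
    rw [Finset.sum_range_succ _ (n + 1), add_comm (∑ i ∈ _, _), ← add_assoc]
    refine add_le_add_left ?_ _
    -- The part of `v ⊓ p (n + 1)` not passed on to `p (n + 2)` lies under `q (n + 1)`, hence in the
    -- overlap of index `n + 1`.
    have h1 : v ⊓ p (n + 1) ≤ v ⊓ p (n + 2) + v ⊓ q (n + 1) :=
      inf_le_left.trans ((le_inf le_rfl (h (n + 1))).trans
        (inf_add_le_inf_add_inf hv (hp _) (hq _)))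
    calc v ⊓ p (n + 1)
        ≤ p (n + 1) ⊓ (v ⊓ p (n + 2) + v ⊓ q (n + 1)) := le_inf inf_le_right h1
      _ ≤ p (n + 1) ⊓ (v ⊓ p (n + 2)) + p (n + 1) ⊓ (v ⊓ q (n + 1)) :=
        inf_add_le_inf_add_inf (hp _) (le_inf hv (hp _)) (le_inf hv (hq _))
      _ ≤ _ := add_le_add inf_le_right (inf_le_inf_left _ inf_le_right)

/-- Truncations of `a` and `b` at `(n + 1) • d` differ by at most `d`, up to the parts of `a`
and `b` that lie strictly on different sides of some level `i • d`. -/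
theorem inf_sub_inf_le_add_sum {a b d : G} (hb : 0 ≤ b) (hd : 0 ≤ d) (n : ℕ) :
    a ⊓ (n + 1) • d - b ⊓ (n + 1) • d ≤
      d + ∑ i ∈ Finset.range (n + 1), (a - i • d)⁺ ⊓ (b - i • d)⁻ := by
  set C := (n + 1) • d with hC
  have hC0 : 0 ≤ C := nsmul_nonneg hd _
  -- The shift by one in the index of `p` absorbs the `- d`. The chain ends because `p (n + 1) = 0`
  -- at the cap `C`, and starts because `b ⊓ C ≥ 0` gives `q 0 = 0`.
  have key := le_inf_add_sum_inf (v := (a ⊓ C - b ⊓ C - d)⁺) (p := fun i => (a ⊓ C - i • d)⁺)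
    (q := fun i => (b ⊓ C - i • d)⁻) (posPart_nonneg _) (fun i => posPart_nonneg _)
    (fun i => negPart_nonneg _) (fun i => sup_le ?_ ?_) ?_ n
  · have hp : (a ⊓ C - (n + 1) • d)⁺ = 0 := posPart_eq_zero.2 (sub_nonpos.2 inf_le_right)
    rw [hp, inf_eq_right.2 (posPart_nonneg _), zero_add] at key
    rw [← sub_le_iff_le_add']
    refine (le_posPart _).trans (key.trans (Finset.sum_le_sum fun i hi => inf_le_inf ?_ ?_))
    · exact posPart_mono (sub_le_sub_right inf_le_left _)
    · have hiC : i • d ≤ C := nsmul_le_nsmul_left hd (Finset.mem_range.1 hi).le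
      rw [negPart_def, neg_sub, sub_inf]
      refine sup_le (sup_le ?_ ((sub_nonpos.2 hiC).trans (negPart_nonneg _))) (negPart_nonneg _)
      rw [← neg_sub]
      exact neg_le_negPart _
  · calc a ⊓ C - b ⊓ C - d = (a ⊓ C - (i + 1) • d) + -(b ⊓ C - i • d) := by
          rw [succ_nsmul]; abel
      _ ≤ _ := add_le_add (le_posPart _) (neg_le_negPart _)
  · exact add_nonneg (posPart_nonneg _) (negPart_nonneg _)
  · simpa using le_inf hb hC0

theorem abs_inf_sub_inf_le_add_sum {a b d : G} (ha : 0 ≤ a) (hb : 0 ≤ b) (hd : 0 ≤ d) (n : ℕ) :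
    |a ⊓ (n + 1) • d - b ⊓ (n + 1) • d| ≤
      d + (∑ i ∈ Finset.range (n + 1), (a - i • d)⁺ ⊓ (b - i • d)⁻ +
        ∑ i ∈ Finset.range (n + 1), (b - i • d)⁺ ⊓ (a - i • d)⁻) := by
  have h : ∀ u v : G, 0 ≤ ∑ i ∈ Finset.range (n + 1), (u - i • d)⁺ ⊓ (v - i • d)⁻ := fun u v =>
    Finset.sum_nonneg fun i _ => le_inf (posPart_nonneg _) (negPart_nonneg _)
  refine abs_le'.2 ⟨?_, ?_⟩
  · exact (inf_sub_inf_le_add_sum hb hd n).trans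
      (add_le_add_right (le_add_of_nonneg_right (h b a)) d)
  · rw [neg_sub]
    exact (inf_sub_inf_le_add_sum ha hd n).trans
      (add_le_add_right (le_add_of_nonneg_left (h a b)) d)

theorem abs_inf_sub_inf_le {a b c : G} (ha : 0 ≤ a) (hb : 0 ≤ b) (hc : 0 ≤ c) :
    |a ⊓ c - b ⊓ c| ≤ c :=
  abs_le'.2 ⟨(sub_le_self _ (le_inf hb hc)).trans inf_le_right, by
    rw [neg_sub]; exact (sub_le_self _ (le_inf ha hc)).trans inf_le_right⟩

end LatticeGroup

/-! ### Almost maximal convex combinations and convergence of truncations -/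

/-- Almost maximising a nonnegative bounded functional `J` over a decreasing sequence of sets. -/
theorem exists_asymptotically_maximizing {E : Type*} {K : ℕ → Set E} (hK : Antitone K)
    (hne : ∀ n, (K n).Nonempty) {J : E → ℝ} {B : ℝ} (h0 : ∀ n, ∀ v ∈ K n, 0 ≤ J v)
    (hB : ∀ n, ∀ v ∈ K n, J v ≤ B) :
    ∃ y : ℕ → E, (∀ n, y n ∈ K n) ∧ ∀ ε > 0, ∃ N, ∀ m ≥ N, ∀ n ≥ N, ∀ v ∈ K N,
      J v - (J (y m) + J (y n)) / 2 < ε := by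
  have hbdd : ∀ n, BddAbove (J '' K n) := fun n => ⟨B, by rintro _ ⟨v, hv, rfl⟩; exact hB n v hv⟩
  have hanti : Antitone fun n => sSup (J '' K n) := fun m n hmn =>
    csSup_le_csSup (hbdd m) ((hne n).image J) (Set.image_mono (hK hmn))
  have hbelow : BddBelow (Set.range fun n => sSup (J '' K n)) := ⟨0, by
    rintro _ ⟨n, rfl⟩
    exact Real.sSup_nonneg (by rintro _ ⟨v, hv, rfl⟩; exact h0 n v hv)⟩
  have hlim := tendsto_atTop_ciInf hanti hbelow
  set L := ⨅ n, sSup (J '' K n)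
  have hex : ∀ n : ℕ, ∃ v ∈ K n, sSup (J '' K n) - 1 / ((n : ℝ) + 1) < J v := fun n => by
    obtain ⟨_, ⟨v, hv, rfl⟩, h⟩ := exists_lt_of_lt_csSup ((hne n).image J)
      (sub_lt_self (sSup (J '' K n)) (Nat.one_div_pos_of_nat (α := ℝ) (n := n)))
    exact ⟨v, hv, h⟩
  choose y hy hyJ using hex
  refine ⟨y, hy, fun ε hε => ?_⟩
  have hlim' := hlim.add (tendsto_one_div_add_atTop_nhds_zero_nat (𝕜 := ℝ))
  rw [add_zero] at hlim'
  -- `N` makes the supremum over `K N` plus the slack `1 / (N + 1)` less than `L + ε`, while later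
  -- values `J (y n)` exceed `L - 1 / (N + 1)`.
  obtain ⟨N, hN⟩ := (hlim'.eventually (gt_mem_nhds (lt_add_of_pos_right L hε))).exists
  have hlow : ∀ n ≥ N, L - 1 / ((N : ℝ) + 1) < J (y n) := fun n hn => by
    have h1 : L ≤ sSup (J '' K n) := ciInf_le hbelow n
    have h2 : 1 / ((n : ℝ) + 1) ≤ 1 / ((N : ℝ) + 1) := Nat.one_div_le_one_div hn
    linarith [hyJ n]
  refine ⟨N, fun m hm n hn v hv => ?_⟩
  have h1 : J v ≤ sSup (J '' K N) := le_csSup (hbdd N) ⟨v, hv, rfl⟩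
  linarith [hlow m hm, hlow n hn]

section

variable {X : Type u} [NormedAddCommGroup X] [Lattice X] [NormedSpace ℝ X]
  [IsOrderedAddMonoid X] [IsOrderedModule ℝ X]

/-- A lower bound for the defect of concavity of a truncation. -/
theorem half_smul_inf_le_midpoint_inf_sub (a b c : X) :
    (1 / 2 : ℝ) • ((a - c)⁺ ⊓ (b - c)⁻) ≤
      ((1 / 2 : ℝ) • a + (1 / 2 : ℝ) • b) ⊓ c -
        ((1 / 2 : ℝ) • (a ⊓ c) + (1 / 2 : ℝ) • (b ⊓ c)) := by
  have hc : (1 / 2 : ℝ) • a + (1 / 2 : ℝ) • b - c = (1 / 2 : ℝ) • ((a - c) + (b - c)) := by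
    module
  calc (1 / 2 : ℝ) • ((a - c)⁺ ⊓ (b - c)⁻)
      ≤ (1 / 2 : ℝ) • ((a - c)⁺ + (b - c)⁺ - ((a - c) + (b - c))⁺) :=
        smul_le_smul_of_nonneg_left (posPart_inf_negPart_le _ _) (by norm_num)
    _ = _ := by
        rw [inf_eq_sub_posPart_sub _ c, inf_eq_sub_posPart_sub a c, inf_eq_sub_posPart_sub b c, hc,
          posPart_smul_of_pos (by norm_num)]
        module

/-- Forward convex combinations of positive elements that asymptotically lie on the same side of
each of countably many given levels, as measured by a positive functional. -/
theorem exists_forwardConvex_tendsto_overlap {φ : X →L[ℝ] ℝ} (hφ : ∀ x, 0 ≤ x → 0 ≤ φ x)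
    {c : ℕ → X} (hc : ∀ i, 0 ≤ c i) {x : ℕ → X} (hx : ∀ n, 0 ≤ x n) :
    ∃ y ∈ forwardConvexSequences x, (∀ n, 0 ≤ y n) ∧
      ∀ i, Tendsto (fun p : ℕ × ℕ => φ ((y p.1 - c i)⁺ ⊓ (y p.2 - c i)⁻)) atTop (𝓝 0) := by
  let K : ℕ → Set X := fun n => convexHull ℝ (x '' Set.Ici n)
  have hK : Antitone K := fun m n hmn =>
    convexHull_mono (Set.image_mono (Set.Ici_subset_Ici.2 hmn))
  have hne : ∀ n, (K n).Nonempty := fun n =>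
    ⟨x n, subset_convexHull ℝ _ ⟨n, Set.self_mem_Ici, rfl⟩⟩
  have hpos : ∀ n, ∀ v ∈ K n, 0 ≤ v := fun n v hv =>
    convexHull_min (t := Set.Ici 0) (by rintro _ ⟨m, -, rfl⟩; exact hx m) (convex_Ici 0) hv
  have hmono : ∀ a b, a ≤ b → φ a ≤ φ b := fun a b h => by simpa using hφ _ (sub_nonneg.2 h)
  -- These weights bound the `i`-th term of `J` by `2⁻ⁱ` uniformly in `v ≥ 0`, so no norm bound on
  -- `x` is needed.
  let t : ℕ → ℝ := fun i => (1 / 2 : ℝ) ^ i / (1 + φ (c i))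
  have hden : ∀ i, 0 < 1 + φ (c i) := fun i => by linarith [hφ _ (hc i)]
  have ht : ∀ i, 0 < t i := fun i => div_pos (by positivity) (hden i)
  let J : X → ℝ := fun v => ∑' i, t i * φ (v ⊓ c i)
  have hterm0 : ∀ v, 0 ≤ v → ∀ i, 0 ≤ t i * φ (v ⊓ c i) := fun v hv i =>
    mul_nonneg (ht i).le (hφ _ (le_inf hv (hc i)))
  have htermB : ∀ v i, t i * φ (v ⊓ c i) ≤ (1 / 2 : ℝ) ^ i := fun v i => by
    rw [div_mul_eq_mul_div, div_le_iff₀ (hden i)]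
    refine mul_le_mul_of_nonneg_left ?_ (by positivity)
    linarith [hmono _ _ (inf_le_right : v ⊓ c i ≤ c i)]
  have hs : ∀ v, 0 ≤ v → Summable fun i => t i * φ (v ⊓ c i) := fun v hv =>
    Summable.of_nonneg_of_le (hterm0 v hv) (htermB v) summable_geometric_two
  obtain ⟨y, hyK, hy⟩ := exists_asymptotically_maximizing hK hne (J := J)
    (fun n v hv => tsum_nonneg (hterm0 v (hpos n v hv)))
    (fun n v hv => (hs v (hpos n v hv)).tsum_le_tsum (htermB v) summable_geometric_two)
  have hy0 : ∀ n, 0 ≤ y n := fun n => hpos n _ (hyK n)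
  refine ⟨y, hyK, hy0, fun i => ?_⟩
  have hover : ∀ a b : X, 0 ≤ a → 0 ≤ b → ∀ j, t j * ((1 / 2) * φ ((a - c j)⁺ ⊓ (b - c j)⁻)) ≤
      t j * φ (((1 / 2 : ℝ) • a + (1 / 2 : ℝ) • b) ⊓ c j) -
        (t j * φ (a ⊓ c j) + t j * φ (b ⊓ c j)) / 2 := fun a b ha hb j => by
    have := hmono _ _ (half_smul_inf_le_midpoint_inf_sub a b (c j))
    simp only [map_sub, map_add, map_smul, smul_eq_mul] at this
    have := mul_le_mul_of_nonneg_left this (ht j).le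
    linarith
  have hr : ∀ a b : X, 0 ≤ φ ((a - c i)⁺ ⊓ (b - c i)⁻) := fun a b =>
    hφ _ (le_inf (posPart_nonneg _) (negPart_nonneg _))
  have hJ : ∀ a b : X, 0 ≤ a → 0 ≤ b → t i * ((1 / 2) * φ ((a - c i)⁺ ⊓ (b - c i)⁻)) ≤
      J ((1 / 2 : ℝ) • a + (1 / 2 : ℝ) • b) - (J a + J b) / 2 := by
    intro a b ha hb
    have hab : (0 : X) ≤ (1 / 2 : ℝ) • a + (1 / 2 : ℝ) • b :=
      add_nonneg (smul_nonneg (by norm_num) ha) (smul_nonneg (by norm_num) hb)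
    have hsum := ((hs _ hab).hasSum.sub
      (((hs a ha).hasSum.add (hs b hb).hasSum).div_const 2))
    -- All defects are nonnegative, so the one at level `i` is at most the total defect of `J`.
    refine (hover a b ha hb i).trans (le_hasSum hsum i fun j _ => ?_)
    exact (mul_nonneg (ht j).le (mul_nonneg (by norm_num)
      (hφ _ (le_inf (posPart_nonneg _) (negPart_nonneg _))))).trans (hover a b ha hb j)
  rw [Metric.tendsto_atTop]
  intro ε hε
  obtain ⟨N, hN⟩ := hy (t i * (1 / 2 * ε)) (mul_pos (ht i) (by positivity))
  refine ⟨(N, N), fun p hp => ?_⟩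
  rw [Real.dist_0_eq_abs, abs_of_nonneg (hr _ _)]
  have hmid : (1 / 2 : ℝ) • y p.1 + (1 / 2 : ℝ) • y p.2 ∈ K N :=
    convex_convexHull ℝ _ (hK hp.1 (hyK p.1)) (hK hp.2 (hyK p.2)) (by norm_num) (by norm_num)
      (by norm_num)
  have h1 := (hJ _ _ (hy0 p.1) (hy0 p.2)).trans_lt (hN p.1 hp.1 p.2 hp.2 _ hmid)
  have h2 := lt_of_mul_lt_mul_left h1 (ht i).le
  linarith

variable [HasSolidNorm X] [CompleteSpace X]

/-- In a Banach lattice with order continuous norm, every sequence of positive elements has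
forward convex combinations all of whose truncations at multiples of `z` converge in norm. -/
theorem HasOrderContinuousNorm.exists_forwardConvex_cauchySeq_inf (hX : HasOrderContinuousNorm X)
    {x : ℕ → X} (hx : ∀ n, 0 ≤ x n) {z : X} (hz : 0 ≤ z) :
    ∃ y ∈ forwardConvexSequences x, (∀ n, 0 ≤ y n) ∧
      ∀ M : ℕ, 0 < M → CauchySeq fun n => y n ⊓ (M : ℝ) • z := by
  obtain ⟨φ, hφ, hφz⟩ := hX.exists_strictly_positive hz
  have hmono : ∀ a b, a ≤ b → φ a ≤ φ b := fun a b h => by simpa using hφ _ (sub_nonneg.2 h)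
  -- One sequence `y` must serve every mesh `1 / (P + 1)`, so all rational levels are treated at
  -- once; absolute values keep them nonnegative.
  obtain ⟨q, hq⟩ := exists_surjective_nat ℚ
  obtain ⟨y, hyx, hy0, hy⟩ := exists_forwardConvex_tendsto_overlap hφ
    (c := fun i => |(q i : ℝ)| • z) (fun i => smul_nonneg (abs_nonneg _) hz) hx
  refine ⟨y, hyx, hy0, fun M hM => ?_⟩
  have hM0 : (0 : ℝ) < M := Nat.cast_pos.2 hM
  have hMz : 0 ≤ (M : ℝ) • z := smul_nonneg hM0.le hz
  have hφM : ∀ u, 0 ≤ u → u ≤ (M : ℝ) • z → φ u = 0 → u = 0 := fun u hu huM h0 => by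
    have h1 : (M : ℝ)⁻¹ • u = 0 := hφz _ (smul_nonneg (inv_nonneg.2 hM0.le) hu)
      (by simpa [smul_smul, hM0.ne'] using
        smul_le_smul_of_nonneg_left huM (inv_nonneg.2 hM0.le)) (by simp [h0])
    simpa [hM0.ne'] using h1
  rw [cauchySeq_iff_tendsto_dist_atTop_0, Metric.tendsto_nhds]
  intro ε hε
  obtain ⟨δ, hδ, hsmall⟩ := hX.exists_norm_lt_of_apply_lt hφ hφM hε
  -- The mesh `d = z / (P + 1)` then satisfies `φ d < δ`, leaving room for the vanishing overlaps.
  obtain ⟨P, hP⟩ := exists_nat_gt (φ z / δ)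
  have hP0 : (0 : ℝ) < (P : ℝ) + 1 := by positivity
  set d : X := (1 / ((P : ℝ) + 1)) • z with hd
  have hd0 : 0 ≤ d := smul_nonneg (by positivity) hz
  have hφd : φ d < δ := by
    rw [hd, map_smul, smul_eq_mul, one_div_mul_eq_div, div_lt_iff₀ hP0]
    rw [div_lt_iff₀ hδ] at hP
    linarith
  have hlevel : ∀ j : ℕ, Tendsto (fun p : ℕ × ℕ => φ ((y p.1 - j • d)⁺ ⊓ (y p.2 - j • d)⁻))
      atTop (𝓝 0) := fun j => by
    obtain ⟨i, hi⟩ := hq ((j : ℚ) / ((P : ℚ) + 1))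
    have : |(q i : ℝ)| • z = j • d := by
      rw [hi, hd, ← Nat.cast_smul_eq_nsmul ℝ, smul_smul, mul_one_div]
      push_cast
      rw [abs_of_nonneg (by positivity)]
    simpa only [this] using hy i
  obtain ⟨n, hn⟩ : ∃ n, M * (P + 1) = n + 1 := ⟨M * (P + 1) - 1, by
    have := Nat.mul_pos hM P.succ_pos
    rw [Nat.succ_eq_add_one] at this
    omega⟩
  have hnd : (n + 1) • d = (M : ℝ) • z := by
    rw [← hn, hd, ← Nat.cast_smul_eq_nsmul ℝ, smul_smul]
    push_cast
    rw [mul_assoc, mul_one_div_cancel hP0.ne', mul_one]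
  have hswap : Tendsto (Prod.swap : ℕ × ℕ → ℕ × ℕ) atTop atTop := by
    rw [← prod_atTop_atTop_eq]
    exact tendsto_prod_swap
  have hlim : Tendsto (fun p : ℕ × ℕ => φ d +
      (∑ i ∈ Finset.range (n + 1), φ ((y p.1 - i • d)⁺ ⊓ (y p.2 - i • d)⁻) +
        ∑ i ∈ Finset.range (n + 1), φ ((y p.2 - i • d)⁺ ⊓ (y p.1 - i • d)⁻))) atTop
      (𝓝 (φ d)) := by
    have h1 := tendsto_finsetSum (Finset.range (n + 1)) fun i _ => hlevel i
    have h2 := tendsto_finsetSum (Finset.range (n + 1)) fun i _ => (hlevel i).comp hswap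
    simpa using (h1.add h2).const_add (φ d)
  filter_upwards [hlim.eventually (gt_mem_nhds hφd)] with p hp
  rw [Real.dist_0_eq_abs, abs_of_nonneg dist_nonneg, dist_eq_norm, ← norm_abs_eq_norm]
  refine hsmall _ (abs_nonneg _) (abs_inf_sub_inf_le (hy0 _) (hy0 _) hMz) (lt_of_le_of_lt ?_ hp)
  have h := hmono _ _ (abs_inf_sub_inf_le_add_sum (hy0 p.1) (hy0 p.2) hd0 n)
  rw [hnd] at h
  simpa only [map_add, map_sum] using h

end

theorem mainTheorem2 {X : Type u} [NormedAddCommGroup X] [NormedSpace ℝ X] [CompleteSpace X]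
    [Lattice X] [IsOrderedAddMonoid X] [IsOrderedModule ℝ X] [HasSolidNorm X]
    (hX : HasOrderContinuousNorm X)
    (x : ℕ → X) (hx : ∀ n, 0 ≤ x n) (z : X) (hz : 0 ≤ z) :
    ∃ y ζ ξ : ℕ → X,
      (∀ n, 0 ≤ y n) ∧ (∀ n, 0 ≤ ζ n) ∧ (∀ k, 0 ≤ ξ k) ∧
      y ∈ forwardConvexSequences x ∧
      (∀ n, ζ n ≤ y n) ∧
      Monotone ξ ∧
      ∀ k : ℕ,
        Tendsto (fun n => ‖ζ n ⊓ ((2 : ℝ) ^ k • z) - ξ k‖) atTop (𝓝 0) ∧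
        Tendsto (fun n => toWeakSpace ℝ X (y n ⊓ ((2 : ℝ) ^ k • z))) atTop
          (𝓝 (toWeakSpace ℝ X (ξ k))) := by
  obtain ⟨y, hyx, hy0, hy⟩ := hX.exists_forwardConvex_cauchySeq_inf hx hz
  have hlim : ∀ k : ℕ, ∃ a, Tendsto (fun n => y n ⊓ ((2 : ℝ) ^ k • z)) atTop (𝓝 a) := fun k =>
    cauchySeq_tendsto_of_complete (by simpa using hy (2 ^ k) (by positivity))
  choose ξ hξ using hlim
  -- Norm convergence holds for `y` itself, so no smaller `ζ` is required.
  refine ⟨y, y, ξ, hy0, hy0, fun k => ge_of_tendsto' (hξ k) fun n =>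
    le_inf (hy0 n) (smul_nonneg (by positivity) hz), hyx, fun n => le_rfl,
    monotone_nat_of_le_succ fun k => ?_, fun k => ⟨?_, ?_⟩⟩
  · exact le_of_tendsto_of_tendsto' (hξ k) (hξ (k + 1)) fun n => inf_le_inf_left _
      (smul_le_smul_of_nonneg_right (pow_le_pow_right₀ one_le_two k.le_succ) hz)
  · exact tendsto_iff_norm_sub_tendsto_zero.1 (hξ k)
  · exact ((toWeakSpaceCLM ℝ X).continuous.tendsto _).comp (hξ k)
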